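/- Let $E=(E^0,E^1,r,s)$ be a row-finite directed graph (every vertex emits only finitely many edges), let $K$ be a field, and let $L_K(E)$ be the Leavitt path algebra of $E$, i.e. the universal associative (not necessarily unital) $K$-algebra generated by pairwise orthogonal idempotents $v\in E^0$ and elements $e,e^*$, $e\in E^1$, with $s(e)e=e\,r(e)=e$, $r(e)e^*=e^*s(e)=e^*$, $e^*f=\delta_{e,f}\,r(e)$ for all $e,f\in E^1$, and $v=\sum_{s(e)=v}ee^*$ for every vertex $v$ that emits at least one and only finitely many edges. Let $H\subseteq E^0$ be hereditary (if a finite path starts in $H$, it ends in $H$) and saturated (if $v$ emits at least one and only finitely many edges and all of these have range in $H$, then $v\in H$). Let $E/H$ be the quotient graph, with vertex set $E^0\setminus H$ and edge set $\{e\in E^1: r(e)\notin H\}$ and the restricted range and source maps, and let $I(H)$ be the two-sided ideal of $L_K(E)$ generated by $H$. A cycle is a path $e_1\cdots e_n$, $n\ge 1$, with $r(e_n)=s(e_1)$ and $s(e_i)\ne s(e_j)$ for $i\neq j$; an exit for it is an edge $e$ with $s(e)=s(e_i)$ and $e\ne e_i$ for some $i$; a graph satisfies Condition (L) if each of its cycles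 has an exit. Let $P_c(E)$ be the set of all vertices lying on cycles without exits in $E$. For a subset $X$ of an algebra $A$ put $X^\perp=\{a\in A: ax=xa=0\text{ for all }x\in X\}$; an ideal $J$ of $A$ is regular if $J=J^{\perp\perp}$. 1. If $E/H$ satisfies Condition (L), then $P_c(E)\subseteq H$. 2. If $I(H)$ is regular, then $E/H$ satisfies Condition (L) if and only if $P_c(E)\subseteq H$. -/

import Mathlib

/-- A directed graph with vertex set `V` and edge set `Ed`, given by its source map `s` and its
range map `r`. -/
structure DirectedGraph (V Ed : Type*) where
  s : Ed → V
  r : Ed → V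

namespace DirectedGraph

section Graph

variable {V Ed : Type*} (E : DirectedGraph V Ed)

/-- Every vertex emits only finitely many edges. -/
def RowFinite : Prop := ∀ v : V, {e : Ed | E.s e = v}.Finite

/-- `E.IsPath [e₁, …, eₙ] u v`: the edges `e₁, …, eₙ` form a finite path with source `u` and
range `v`. The empty list is the trivial path at a vertex. -/
def IsPath : List Ed → V → V → Prop
  | [], u, v => u = v
  | e :: α, u, v => E.s e = u ∧ IsPath α (E.r e) v

/-- The set of vertices of a (nontrivial) path. -/
def pathVertices (α : List Ed) : Set V := {v | ∃ e ∈ α, v = E.s e ∨ v = E.r e}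

/-- A cycle is a nontrivial closed path whose edges have pairwise distinct sources. -/
def IsCycle (α : List Ed) : Prop :=
  α ≠ [] ∧ (∃ v, E.IsPath α v v) ∧ (α.map E.s).Nodup

/-- The edge `e` is an exit for the path `α`. -/
def IsExit (e : Ed) (α : List Ed) : Prop := ∃ f ∈ α, E.s e = E.s f ∧ e ≠ f

/-- Condition (L): every cycle has an exit. -/
def ConditionL : Prop := ∀ c : List Ed, E.IsCycle c → ∃ e, E.IsExit e c

/-- `P_c(E)`: the set of all vertices on cycles without exits. -/
def Pc : Set V := {v | ∃ c : List Ed, E.IsCycle c ∧ (¬ ∃ e, E.IsExit e c) ∧ v ∈ E.pathVertices c}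

/-- A regular vertex emits at least one and only finitely many edges. -/
def IsRegularVertex (v : V) : Prop :=
  {e : Ed | E.s e = v}.Nonempty ∧ {e : Ed | E.s e = v}.Finite

def IsHereditary (H : Set V) : Prop :=
  ∀ (α : List Ed) (u v : V), E.IsPath α u v → u ∈ H → v ∈ H

def IsSaturated (H : Set V) : Prop :=
  ∀ v : V, E.IsRegularVertex v → (∀ e, E.s e = v → E.r e ∈ H) → v ∈ H

/-- The quotient graph `E/H` by a hereditary set `H`: its vertices are the vertices outside `H`,
its edges are the edges whose range is outside `H`. -/
def quotient (H : Set V) (hH : E.IsHereditary H) :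
    DirectedGraph {v : V // v ∉ H} {e : Ed // E.r e ∉ H} where
  s e := ⟨E.s e.1, fun h => e.2 (hH [e.1] _ _ ⟨rfl, rfl⟩ h)⟩
  r e := ⟨E.r e.1, e.2⟩

end Graph

/-- The symbols that generate a Leavitt path algebra: the vertices `v`, the edges `e` and the ghost
edges `e*`. -/
inductive Gen (V Ed : Type*)
  | vertex (v : V) : Gen V Ed
  | edge (e : Ed) : Gen V Ed
  | ghost (e : Ed) : Gen V Ed

section Leavitt

variable (K : Type*) [Field K] {V Ed : Type*} (E : DirectedGraph V Ed)

/-- The free associative (non-unital) `K`-algebra on the generating symbols. -/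
abbrev FreeAlg (K : Type*) [Field K] (V Ed : Type*) : Type _ :=
  MonoidAlgebra K (FreeSemigroup (Gen V Ed))

/-- A generating symbol as an element of the free algebra. -/
noncomputable def FreeAlg.gen (x : Gen V Ed) : FreeAlg K V Ed :=
  MonoidAlgebra.ofMagma K (FreeSemigroup (Gen V Ed)) (FreeSemigroup.of x)

/-- The images `x` of the generating symbols in an algebra satisfy the defining relations of the
Leavitt path algebra of `E`. -/
structure IsLeavittFamily {A : Type*} [NonUnitalRing A] (x : Gen V Ed → A) : Prop where
  idem : ∀ v, x (.vertex v) * x (.vertex v) = x (.vertex v)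
  orth : ∀ v w, v ≠ w → x (.vertex v) * x (.vertex w) = 0
  source_edge : ∀ e, x (.vertex (E.s e)) * x (.edge e) = x (.edge e)
  edge_range : ∀ e, x (.edge e) * x (.vertex (E.r e)) = x (.edge e)
  range_ghost : ∀ e, x (.vertex (E.r e)) * x (.ghost e) = x (.ghost e)
  ghost_source : ∀ e, x (.ghost e) * x (.vertex (E.s e)) = x (.ghost e)
  ghost_edge_self : ∀ e, x (.ghost e) * x (.edge e) = x (.vertex (E.r e))
  ghost_edge_ne : ∀ e f, e ≠ f → x (.ghost e) * x (.edge f) = 0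
  regular : ∀ v (hv : E.IsRegularVertex v),
    x (.vertex v) = ∑ e ∈ hv.2.toFinset, x (.edge e) * x (.ghost e)

open FreeAlg in
/-- The defining relations of the Leavitt path algebra, closed under the algebra operations. The
equivalence relation generated by `LeavittRel` is the congruence generated by the relations. -/
inductive LeavittRel : FreeAlg K V Ed → FreeAlg K V Ed → Prop
  | idem (v : V) :
      LeavittRel (gen K (.vertex v) * gen K (.vertex v)) (gen K (.vertex v))
  | orth (v w : V) : v ≠ w → LeavittRel (gen K (.vertex v) * gen K (.vertex w)) 0
  | source_edge (e : Ed) :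
      LeavittRel (gen K (.vertex (E.s e)) * gen K (.edge e)) (gen K (.edge e))
  | edge_range (e : Ed) :
      LeavittRel (gen K (.edge e) * gen K (.vertex (E.r e))) (gen K (.edge e))
  | range_ghost (e : Ed) :
      LeavittRel (gen K (.vertex (E.r e)) * gen K (.ghost e)) (gen K (.ghost e))
  | ghost_source (e : Ed) :
      LeavittRel (gen K (.ghost e) * gen K (.vertex (E.s e))) (gen K (.ghost e))
  | ghost_edge_self (e : Ed) :
      LeavittRel (gen K (.ghost e) * gen K (.edge e)) (gen K (.vertex (E.r e)))
  | ghost_edge_ne (e f : Ed) : e ≠ f → LeavittRel (gen K (.ghost e) * gen K (.edge f)) 0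
  | regular (v : V) (hv : E.IsRegularVertex v) :
      LeavittRel (gen K (.vertex v)) (∑ e ∈ hv.2.toFinset, gen K (.edge e) * gen K (.ghost e))
  | smul (k : K) {a b : FreeAlg K V Ed} : LeavittRel a b → LeavittRel (k • a) (k • b)
  | add_right {a b : FreeAlg K V Ed} (c : FreeAlg K V Ed) :
      LeavittRel a b → LeavittRel (a + c) (b + c)
  | mul_left (a : FreeAlg K V Ed) {b c : FreeAlg K V Ed} :
      LeavittRel b c → LeavittRel (a * b) (a * c)
  | mul_right {a b : FreeAlg K V Ed} (c : FreeAlg K V Ed) :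
      LeavittRel a b → LeavittRel (a * c) (b * c)

variable {K E}

theorem LeavittRel.add_left (a : FreeAlg K V Ed) {b c : FreeAlg K V Ed}
    (h : LeavittRel K E b c) : LeavittRel K E (a + b) (a + c) := by
  rw [add_comm _ b, add_comm _ c]; exact h.add_right _

theorem LeavittRel.neg {a b : FreeAlg K V Ed} (h : LeavittRel K E a b) :
    LeavittRel K E (-a) (-b) := by
  simpa only [neg_one_smul] using h.smul (-1)

theorem LeavittRel.sub_left (a : FreeAlg K V Ed) {b c : FreeAlg K V Ed}
    (h : LeavittRel K E b c) : LeavittRel K E (a - b) (a - c) := by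
  simpa only [sub_eq_add_neg] using h.neg.add_left a

theorem LeavittRel.sub_right {a b : FreeAlg K V Ed} (c : FreeAlg K V Ed)
    (h : LeavittRel K E a b) : LeavittRel K E (a - c) (b - c) := by
  simpa only [sub_eq_add_neg] using h.add_right (-c)

theorem LeavittRel.nsmul (n : ℕ) {a b : FreeAlg K V Ed} (h : LeavittRel K E a b) :
    LeavittRel K E (n • a) (n • b) := by
  simpa only [Nat.cast_smul_eq_nsmul] using h.smul (n : K)

theorem LeavittRel.zsmul (n : ℤ) {a b : FreeAlg K V Ed} (h : LeavittRel K E a b) :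
    LeavittRel K E (n • a) (n • b) := by
  simpa only [Int.cast_smul_eq_zsmul] using h.smul (n : K)

variable (K E)

/-- The Leavitt path algebra `L_K(E)`: the universal (non-unital) associative `K`-algebra generated
by the vertices, edges and ghost edges subject to the defining relations. -/
def LeavittPathAlgebra : Type _ := Quot (LeavittRel K E)

namespace LeavittPathAlgebra

noncomputable instance : Zero (LeavittPathAlgebra K E) where zero := Quot.mk _ 0

noncomputable instance : SMul K (LeavittPathAlgebra K E) where
  smul k := Quot.map (k • ·) fun _ _ h => h.smul k

noncomputable instance : SMul ℕ (LeavittPathAlgebra K E) where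
  smul n := Quot.map (n • ·) fun _ _ h => h.nsmul n

noncomputable instance : SMul ℤ (LeavittPathAlgebra K E) where
  smul n := Quot.map (n • ·) fun _ _ h => h.zsmul n

noncomputable instance : Add (LeavittPathAlgebra K E) where
  add := Quot.map₂ (· + ·) (fun a _ _ h => h.add_left a) fun _ _ c h => h.add_right c

noncomputable instance : Neg (LeavittPathAlgebra K E) where neg := Quot.map Neg.neg fun _ _ h => h.neg

noncomputable instance : Sub (LeavittPathAlgebra K E) where
  sub := Quot.map₂ (· - ·) (fun a _ _ h => h.sub_left a) fun _ _ c h => h.sub_right c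

noncomputable instance : Mul (LeavittPathAlgebra K E) where
  mul := Quot.map₂ (· * ·) (fun a _ _ h => h.mul_left a) fun _ _ c h => h.mul_right c

noncomputable instance : NonUnitalRing (LeavittPathAlgebra K E) :=
  Function.Surjective.nonUnitalRing (Quot.mk (LeavittRel K E)) Quot.mk_surjective rfl
    (fun _ _ => rfl) (fun _ _ => rfl) (fun _ => rfl) (fun _ _ => rfl) (fun _ _ => rfl)
    fun _ _ => rfl

noncomputable instance : Module K (LeavittPathAlgebra K E) :=
  Function.Surjective.module K ⟨⟨Quot.mk (LeavittRel K E), rfl⟩, fun _ _ => rfl⟩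
    Quot.mk_surjective fun _ _ => rfl

instance : IsScalarTower K (LeavittPathAlgebra K E) (LeavittPathAlgebra K E) where
  smul_assoc := by
    rintro k ⟨a⟩ ⟨b⟩
    exact congrArg (Quot.mk _) (smul_mul_assoc k a b)

instance : SMulCommClass K (LeavittPathAlgebra K E) (LeavittPathAlgebra K E) where
  smul_comm := by
    rintro k ⟨a⟩ ⟨b⟩
    exact congrArg (Quot.mk _) (mul_smul_comm k a b).symm

/-- The quotient map from the free algebra. -/
noncomputable def mk : FreeAlg K V Ed →ₙₐ[K] LeavittPathAlgebra K E where
  toFun := Quot.mk (LeavittRel K E)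
  map_smul' _ _ := rfl
  map_zero' := rfl
  map_add' _ _ := rfl
  map_mul' _ _ := rfl

/-- The image of a generating symbol in the Leavitt path algebra. -/
noncomputable def of (x : Gen V Ed) : LeavittPathAlgebra K E := mk K E (FreeAlg.gen K x)

theorem isLeavittFamily_of : E.IsLeavittFamily (of K E) where
  idem v := Quot.sound (.idem v)
  orth v w h := Quot.sound (.orth v w h)
  source_edge e := Quot.sound (.source_edge e)
  edge_range e := Quot.sound (.edge_range e)
  range_ghost e := Quot.sound (.range_ghost e)
  ghost_source e := Quot.sound (.ghost_source e)
  ghost_edge_self e := Quot.sound (.ghost_edge_self e)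
  ghost_edge_ne e f h := Quot.sound (.ghost_edge_ne e f h)
  regular v hv := by
    have h : mk K E (FreeAlg.gen K (.vertex v)) = mk K E (∑ e ∈ hv.2.toFinset,
      FreeAlg.gen K (.edge e) * FreeAlg.gen K (.ghost e)) := Quot.sound (.regular v hv)
    simpa only [map_sum, map_mul, of] using h

/-- The universal property of the Leavitt path algebra. -/
theorem existsUnique_lift {A : Type*} [NonUnitalRing A] [Module K A] [IsScalarTower K A A]
    [SMulCommClass K A A] (x : Gen V Ed → A) (hx : E.IsLeavittFamily x) :
    ∃! φ : LeavittPathAlgebra K E →ₙₐ[K] A, ∀ g, φ (of K E g) = x g := by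
  let F : FreeAlg K V Ed →ₙₐ[K] A := MonoidAlgebra.liftMagma K (FreeSemigroup.lift x)
  have hF : ∀ g, F (FreeAlg.gen K g) = x g := by
    intro g
    simp [F, FreeAlg.gen, MonoidAlgebra.liftMagma]
  have hrel : ∀ a b, LeavittRel K E a b → F a = F b := by
    intro a b h
    induction h with
    | idem v => simp only [map_mul, hF, hx.idem]
    | orth v w h => simp only [map_mul, hF, hx.orth v w h, map_zero]
    | source_edge e => simp only [map_mul, hF, hx.source_edge]
    | edge_range e => simp only [map_mul, hF, hx.edge_range]
    | range_ghost e => simp only [map_mul, hF, hx.range_ghost]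
    | ghost_source e => simp only [map_mul, hF, hx.ghost_source]
    | ghost_edge_self e => simp only [map_mul, hF, hx.ghost_edge_self]
    | ghost_edge_ne e f h => simp only [map_mul, hF, hx.ghost_edge_ne e f h, map_zero]
    | regular v hv => simp only [map_sum, map_mul, hF]; exact hx.regular v hv
    | smul k _ ih => simp only [map_smul, ih]
    | add_right c _ ih => simp only [map_add, ih]
    | mul_left a _ ih => simp only [map_mul, ih]
    | mul_right c _ ih => simp only [map_mul, ih]
  refine ⟨{ toFun := Quot.lift F hrel
            map_smul' := ?_, map_zero' := ?_, map_add' := ?_, map_mul' := ?_ }, hF, ?_⟩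
  · rintro k ⟨a⟩; exact map_smul F k a
  · exact map_zero F
  · rintro ⟨a⟩ ⟨b⟩; exact map_add F a b
  · rintro ⟨a⟩ ⟨b⟩; exact map_mul F a b
  · intro ψ hψ
    have h : ψ.comp (mk K E) = F := by
      apply MonoidAlgebra.nonUnitalAlgHom_ext'
      apply FreeSemigroup.hom_ext
      funext g
      exact (hψ g).trans (hF g).symm
    ext ⟨a⟩
    exact DFunLike.congr_fun h a

end LeavittPathAlgebra

/-- The ideal `I(H)` of `L_K(E)` generated by the vertices in `H`. Vertices are idempotent, so this
two-sided ideal of the ring is automatically a `K`-subspace. -/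
noncomputable def idealOf (H : Set V) : TwoSidedIdeal (LeavittPathAlgebra K E) :=
  TwoSidedIdeal.span ((fun v => LeavittPathAlgebra.of K E (.vertex v)) '' H)

end Leavitt

end DirectedGraph

/-- The annihilator `X^⊥` of a subset `X` of an algebra. -/
def perp {A : Type*} [NonUnitalRing A] (X : Set A) : Set A :=
  {a | ∀ x ∈ X, a * x = 0 ∧ x * a = 0}

/-- An ideal `J` is regular if `J = J^⊥⊥`. -/
def TwoSidedIdeal.IsRegularIdeal {A : Type*} [NonUnitalRing A] (J : TwoSidedIdeal A) : Prop :=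
  (J : Set A) = perp (perp (J : Set A))

/-! Part 1 is graph theory: an exitless cycle of `E` with a vertex outside `H` avoids `H` entirely,
since `H` is hereditary, so it is a cycle of `E/H`, and an exit there would be an exit in `E`.

For the converse in part 2, let `c` be a cycle of `E/H` without exits, based at `v`. Since `P_c(E) ⊆
H`, it has an exit `f` in `E`, and every exit of `c` ends in `H`. It suffices that `v ∈ I(H)^⊥⊥ =
I(H)`, because `I(H)` contains no vertex outside `H` (`mem_of_vertex_mem_idealOf`, by a
representation of `L_K(E)` whose kernel contains a vertex exactly when it lies in `H`).

So let `y ∈ I(H)^⊥`. For large `N` the path `c^N` absorbs all ghost edges of `y`, and `y c^N` is a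
combination of paths into `v`. If `μ` is the segment of `c` from `v` to `s(f)`, then `y c^N μ f =
0`, since `μ f` ends in `H`. Right multiplication by `μ f` is injective on such combinations
(`eq_zero_of_mul_pathElt_eq_zero`), so `y c^N = 0`. Walking back along `c^N` with the relation `u =
∑ g g*` gives `y v = 0` (`mul_source_eq_zero`). The equation `v y = 0` follows in the opposite
algebra. -/

namespace DirectedGraph

/-! ### Paths, cycles and the quotient graph. -/

section Graph

variable {V Ed : Type*} (E : DirectedGraph V Ed)

theorem isPath_append {α β : List Ed} {u w : V} :
    E.IsPath (α ++ β) u w ↔ ∃ v, E.IsPath α u v ∧ E.IsPath β v w := by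
  induction α generalizing u with
  | nil => simp [IsPath]
  | cons e α ih => simp [IsPath, ih, and_assoc]

variable {E}

theorem IsPath.append {α β : List Ed} {u v w : V} (hα : E.IsPath α u v) (hβ : E.IsPath β v w) :
    E.IsPath (α ++ β) u w :=
  E.isPath_append.2 ⟨v, hα, hβ⟩

theorem IsPath.flatten_replicate {c : List Ed} {v : V} (hc : E.IsPath c v v) (k : ℕ) :
    E.IsPath (List.replicate k c).flatten v v := by
  induction k with
  | zero => simp [IsPath]
  | succ k ih => simpa [List.replicate_succ] using hc.append ih

theorem IsPath.exists_split {c : List Ed} {u v : V} (hc : E.IsPath c u v) {e : Ed} (he : e ∈ c) :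
    ∃ μ ν, c = μ ++ e :: ν ∧ E.IsPath μ u (E.s e) ∧ E.IsPath ν (E.r e) v := by
  obtain ⟨μ, ν, rfl⟩ := List.append_of_mem he
  obtain ⟨w, h₁, h₂, h₃⟩ := E.isPath_append.1 hc
  exact ⟨μ, ν, rfl, h₂ ▸ h₁, h₃⟩

theorem isPath_map_val {H : Set V} (hH : E.IsHereditary H) {c : List {e : Ed // E.r e ∉ H}}
    {u v : {v : V // v ∉ H}} :
    E.IsPath (c.map Subtype.val) u.1 v.1 ↔ (E.quotient H hH).IsPath c u v := by
  induction c generalizing u with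
  | nil => simp [IsPath, Subtype.ext_iff]
  | cons e c ih =>
    have := @ih ⟨E.r e.1, e.2⟩
    simpa [IsPath, quotient, Subtype.ext_iff] using fun _ => this

theorem nodup_map_source_val {H : Set V} (hH : E.IsHereditary H)
    {c : List {e : Ed // E.r e ∉ H}} :
    ((c.map Subtype.val).map E.s).Nodup ↔ (c.map (E.quotient H hH).s).Nodup := by
  have : (c.map Subtype.val).map E.s = (c.map (E.quotient H hH).s).map Subtype.val := by
    simp [quotient, Function.comp_def]
  rw [this, List.nodup_map_iff Subtype.val_injective]

theorem Pc_subset_of_conditionL_quotient {H : Set V} (hH : E.IsHereditary H)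
    (hL : (E.quotient H hH).ConditionL) : E.Pc ⊆ H := by
  rintro v ⟨c, ⟨hne, ⟨u, hu⟩, hnd⟩, hex, hv⟩
  by_contra hvH
  -- One edge of the cycle ending in `H` would pull the base `u`, and then every vertex of the
  -- cycle, into `H`.
  have hr : ∀ e ∈ c, E.r e ∉ H := by
    intro e he heH
    obtain ⟨μ, ν, -, -, hν⟩ := hu.exists_split he
    have huH : u ∈ H := hH _ _ _ hν heH
    obtain ⟨f, hf, hvf⟩ := hv
    obtain ⟨μ', ν', -, hμ', -⟩ := hu.exists_split hf
    have hs : E.s f ∈ H := hH _ _ _ hμ' huH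
    rcases hvf with rfl | rfl
    · exact hvH hs
    · exact hvH (hH [f] _ _ ⟨rfl, rfl⟩ hs)
  have huH : u ∉ H := by
    obtain ⟨e, he⟩ := List.exists_mem_of_ne_nil c hne
    obtain ⟨μ, ν, -, hμ, -⟩ := hu.exists_split he
    exact fun h => hr e he (hH (μ ++ [e]) _ _ (hμ.append ⟨rfl, rfl⟩) h)
  lift c to List {e : Ed // E.r e ∉ H} using hr
  obtain ⟨⟨e, he⟩, f, hf, hs, hef⟩ := hL c ⟨fun h => hne (by simp [h]),
    ⟨⟨u, huH⟩, (isPath_map_val hH).1 hu⟩, (nodup_map_source_val hH).1 hnd⟩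
  exact hex ⟨e, f.1, List.mem_map_of_mem hf, congrArg Subtype.val hs,
    fun h => hef (Subtype.ext h)⟩

end Graph

/-! ### A representation that detects the vertices outside `H`. -/

section Representation

variable (K : Type*) [Field K] {V Ed : Type*} (E : DirectedGraph V Ed)

/-- A regular `v ∉ H` emits at least one edge that stays outside `H`, by saturation, and only
finitely many, and (finite nonempty) × ℕ is in bijection with ℕ. Thus the copy of ℕ at `v` splits
into copies of those at the ranges, as `v = ∑ e e*` demands. -/
theorem exists_edge_coding (H : Set V) (hE : E.RowFinite) (hS : E.IsSaturated H) :
    ∃ φ : Ed → ℕ → ℕ,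
      (∀ e e' n n', E.s e = E.s e' → E.r e ∉ H → E.r e' ∉ H → φ e n = φ e' n' →
        e = e' ∧ n = n') ∧
      ∀ v ∉ H, E.IsRegularVertex v → ∀ m, ∃ e n, E.s e = v ∧ E.r e ∉ H ∧ φ e n = m := by
  classical
  have key : ∀ v, Nonempty {e : Ed // E.s e = v ∧ E.r e ∉ H} →
      Nonempty ({e : Ed // E.s e = v ∧ E.r e ∉ H} × ℕ ≃ ℕ) := by
    intro v hv
    have : Finite {e : Ed // E.s e = v ∧ E.r e ∉ H} := (hE v).subset fun e he => he.1
    exact nonempty_equiv_of_countable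
  let ε v hv := (key v hv).some
  let φ : Ed → ℕ → ℕ := fun e n =>
    -- The value 0 for edges into `H` is junk: both properties concern only edges with range outside
    -- `H`.
    if h : E.r e ∉ H then ε (E.s e) ⟨⟨e, rfl, h⟩⟩ (⟨e, rfl, h⟩, n) else 0
  have hφ : ∀ v e n (hs : E.s e = v) (hr : E.r e ∉ H),
      φ e n = ε v ⟨⟨e, hs, hr⟩⟩ (⟨e, hs, hr⟩, n) := by
    rintro v e n rfl hr
    exact dif_pos hr
  refine ⟨φ, fun e e' n n' hs hr hr' h => ?_, fun v hv hreg m => ?_⟩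
  · rw [hφ _ e n hs hr, hφ _ e' n' rfl hr'] at h
    simpa using (ε _ ⟨⟨e', rfl, hr'⟩⟩).injective h
  · have hne : ∃ e, E.s e = v ∧ E.r e ∉ H := by
      by_contra! hcon
      exact hv (hS v hreg hcon)
    obtain ⟨e, he⟩ := hne
    obtain ⟨⟨⟨e', hs, hr⟩, n⟩, rfl⟩ := (ε v ⟨⟨e, he⟩⟩).surjective m
    exact ⟨e', n, hs, hr, hφ v e' n hs hr⟩

open Classical in
/-- The operators on functions `V × ℕ → K` attached to a coding `φ` of the edges: the vertices in
`H` act by zero, and an edge `e` with range outside `H` moves position `(r e, n)` to position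
`(s e, φ e n)`. -/
noncomputable def codingOperator (H : Set V) (φ : Ed → ℕ → ℕ) :
    Gen V Ed → Module.End K (V × ℕ → K)
  | .vertex v =>
    { toFun := fun f p => if p.1 = v ∧ v ∉ H then f p else 0
      map_add' := fun f g => by ext p; by_cases h : p.1 = v ∧ v ∉ H <;> simp [h]
      map_smul' := fun k f => by ext p; simp }
  | .edge e =>
    { toFun := fun f p =>
        if p.1 = E.s e ∧ E.r e ∉ H ∧ φ e ((φ e).invFun p.2) = p.2
        then f (E.r e, (φ e).invFun p.2) else 0
      map_add' := fun f g => by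
        ext p
        by_cases h : p.1 = E.s e ∧ E.r e ∉ H ∧ φ e ((φ e).invFun p.2) = p.2 <;> simp [h]
      map_smul' := fun k f => by ext p; simp }
  | .ghost e =>
    { toFun := fun f p => if p.1 = E.r e ∧ E.r e ∉ H then f (E.s e, φ e p.2) else 0
      map_add' := fun f g => by ext p; by_cases h : p.1 = E.r e ∧ E.r e ∉ H <;> simp [h]
      map_smul' := fun k f => by ext p; simp }

theorem isLeavittFamily_codingOperator {H : Set V} (hH : E.IsHereditary H) {φ : Ed → ℕ → ℕ}
    (hinj : ∀ e e' n n', E.s e = E.s e' → E.r e ∉ H → E.r e' ∉ H → φ e n = φ e' n' →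
      e = e' ∧ n = n')
    (hsurj : ∀ v ∉ H, E.IsRegularVertex v → ∀ m, ∃ e n, E.s e = v ∧ E.r e ∉ H ∧ φ e n = m) :
    E.IsLeavittFamily (codingOperator K E H φ) := by
  have hs : ∀ e, E.r e ∉ H → E.s e ∉ H := fun e h h' => h (hH [e] _ _ ⟨rfl, rfl⟩ h')
  have hinv : ∀ e n, E.r e ∉ H → (φ e).invFun (φ e n) = n := fun e n he =>
    Function.leftInverse_invFun (fun a b h => (hinj e e a b rfl he he h).2) n
  constructor
  · intro v
    ext1 f; funext p
    simp +contextual [codingOperator]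
  · intro v w hvw
    ext1 f; funext p
    simp only [codingOperator, Module.End.mul_apply, LinearMap.coe_mk, AddHom.coe_mk,
      LinearMap.zero_apply, Pi.zero_apply]
    grind
  · intro e
    ext1 f; funext p
    have := hs e
    simp only [codingOperator, Module.End.mul_apply, LinearMap.coe_mk, AddHom.coe_mk]
    grind
  · intro e
    ext1 f; funext p
    simp only [codingOperator, Module.End.mul_apply, LinearMap.coe_mk, AddHom.coe_mk]
    grind
  · intro e
    ext1 f; funext p
    simp only [codingOperator, Module.End.mul_apply, LinearMap.coe_mk, AddHom.coe_mk]
    grind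
  · intro e
    ext1 f; funext p
    have := hs e
    simp only [codingOperator, Module.End.mul_apply, LinearMap.coe_mk, AddHom.coe_mk]
    grind
  · intro e
    ext1 f; funext p
    have := hinv e p.2
    simp only [codingOperator, Module.End.mul_apply, LinearMap.coe_mk, AddHom.coe_mk]
    grind
  · intro e f hef
    ext1 g; funext p
    have := fun h h₁ h₂ => hinj f e ((φ f).invFun (φ e p.2)) p.2 h h₁ h₂
    simp only [codingOperator, Module.End.mul_apply, LinearMap.coe_mk, AddHom.coe_mk,
      LinearMap.zero_apply, Pi.zero_apply]
    grind
  · intro v hv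
    ext1 f; funext p
    obtain ⟨w, m⟩ := p
    simp only [codingOperator, Module.End.mul_apply, LinearMap.coe_mk, AddHom.coe_mk,
      LinearMap.sum_apply, Finset.sum_apply]
    by_cases hw : w = v ∧ v ∉ H
    · obtain ⟨rfl, hwH⟩ := hw
      obtain ⟨e, n, rfl, her, hen⟩ := hsurj w hwH hv m
      -- Only the edge whose code range contains `m` contributes at position `(w, m)`.
      rw [Finset.sum_eq_single e]
      · subst hen
        have := hinv e n her
        grind
      · intro e' he' hne
        have := hinj e' e ((φ e').invFun m) n
        simp only [Set.Finite.mem_toFinset, Set.mem_ofPred_eq] at he'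
        grind
      · intro h
        simp at h
    · rw [if_neg hw, eq_comm]
      refine Finset.sum_eq_zero fun e he => ?_
      simp only [Set.Finite.mem_toFinset, Set.mem_ofPred_eq] at he
      have := hs e
      grind

/-- The only vertices in the ideal generated by a hereditary and saturated set are its elements. -/
theorem mem_of_vertex_mem_idealOf (hE : E.RowFinite) {H : Set V} (hH : E.IsHereditary H)
    (hS : E.IsSaturated H) {v : V}
    (hv : LeavittPathAlgebra.of K E (.vertex v) ∈ E.idealOf K H) : v ∈ H := by
  obtain ⟨φ, hinj, hsurj⟩ := E.exists_edge_coding H hE hS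
  obtain ⟨F, hF, -⟩ := LeavittPathAlgebra.existsUnique_lift K E _
    (E.isLeavittFamily_codingOperator K hH hinj hsurj)
  have h := TwoSidedIdeal.mem_span_iff.1 hv (TwoSidedIdeal.ker F) (by
    rintro _ ⟨w, hw, rfl⟩
    rw [SetLike.mem_coe, TwoSidedIdeal.mem_ker]
    simp only [hF]
    ext1 f; funext p
    simp [codingOperator, hw])
  rw [TwoSidedIdeal.mem_ker, hF] at h
  by_contra hvH
  -- The operator of `v ∉ H` fixes the value 1 of the constant function at `(v, 0)`.
  have := congrFun (LinearMap.congr_fun h 1) (v, 0)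
  simp [codingOperator, hvH] at this

theorem vertex_ne_zero (hE : E.RowFinite) (v : V) : LeavittPathAlgebra.of K E (.vertex v) ≠ 0 := by
  intro h
  refine E.mem_of_vertex_mem_idealOf K hE (H := ∅) (fun _ _ _ _ h => h) ?_ (v := v) ?_
  · rintro v ⟨⟨e, he⟩, -⟩ hr
    exact hr e he
  · rw [h]
    exact zero_mem _

end Representation

end DirectedGraph

namespace DirectedGraph

/-! ### Absorbing ghost edges and cancelling paths. -/

section Family

variable {K : Type*} [Field K] {V Ed : Type*} {E : DirectedGraph V Ed}
  {A : Type*} [NonUnitalRing A] [Module K A] [SMulCommClass K A A]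
  {x : Gen V Ed → A}

/-- The product of the edges of a path with range `v`. -/
def pathElt (x : Gen V Ed → A) : List Ed → V → A
  | [], v => x (.vertex v)
  | e :: α, v => x (.edge e) * pathElt x α v

/-- The product of the ghost edges of a path with range `v`. -/
def ghostElt (x : Gen V Ed → A) : List Ed → V → A
  | [], v => x (.vertex v)
  | e :: α, v => ghostElt x α v * x (.ghost e)

/-- The subspace spanned by the paths of length at least `M`. -/
def longPaths (K : Type*) [Field K] {V Ed : Type*} (E : DirectedGraph V Ed) {A : Type*}
    [NonUnitalRing A] [Module K A] (x : Gen V Ed → A) (M : ℕ) : Submodule K A :=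
  Submodule.span K {a | ∃ α u v, E.IsPath α u v ∧ M ≤ α.length ∧ a = pathElt x α v}

namespace IsLeavittFamily

variable (hx : E.IsLeavittFamily x)
include hx

theorem source_mul_pathElt {α : List Ed} {u v : V} (h : E.IsPath α u v) :
    x (.vertex u) * pathElt x α v = pathElt x α v := by
  cases α with
  | nil => cases h; exact hx.idem _
  | cons e α => rw [pathElt, ← mul_assoc, ← h.1, hx.source_edge]

theorem pathElt_mul_range (α : List Ed) (v : V) :
    pathElt x α v * x (.vertex v) = pathElt x α v := by
  induction α with
  | nil => exact hx.idem _
  | cons e α ih => rw [pathElt, mul_assoc, ih]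

theorem pathElt_mul_pathElt {α β : List Ed} {u v w : V} (hα : E.IsPath α u v)
    (hβ : E.IsPath β v w) : pathElt x α v * pathElt x β w = pathElt x (α ++ β) w := by
  induction α generalizing u with
  | nil => cases hα; exact hx.source_mul_pathElt hβ
  | cons e α ih => rw [pathElt, mul_assoc, ih hα.2]; rfl

theorem ghostElt_mul_pathElt_self {α : List Ed} {u v : V} (hα : E.IsPath α u v) :
    ghostElt x α v * pathElt x α v = x (.vertex v) := by
  induction α generalizing u with
  | nil => exact hx.idem _
  | cons e α ih =>
    rw [ghostElt, pathElt, mul_assoc, ← mul_assoc (x _), hx.ghost_edge_self,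
      hx.source_mul_pathElt hα.2, ih hα.2]

theorem vertex_mul_pathElt_of_ne {α : List Ed} {u v w : V} (h : E.IsPath α u v) (hw : w ≠ u) :
    x (.vertex w) * pathElt x α v = 0 := by
  rw [← hx.source_mul_pathElt h, ← mul_assoc, hx.orth _ _ hw, zero_mul]

theorem pathElt_mul_vertex_of_ne (α : List Ed) {v w : V} (hw : v ≠ w) :
    pathElt x α v * x (.vertex w) = 0 := by
  rw [← hx.pathElt_mul_range, mul_assoc, hx.orth _ _ hw, mul_zero]

theorem ghostElt_mul_pathElt_of_not_prefix {α β : List Ed} {u u' v w : V} (hα : E.IsPath α u v)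
    (hβ : E.IsPath β u' w) (h₁ : ¬ α <+: β) (h₂ : ¬ β <+: α) :
    ghostElt x α v * pathElt x β w = 0 := by
  induction α generalizing β u u' with
  | nil => exact absurd List.nil_prefix h₁
  | cons e α ih =>
    cases β with
    | nil => exact absurd List.nil_prefix h₂
    | cons f β =>
      rw [ghostElt, pathElt, mul_assoc, ← mul_assoc (x _)]
      by_cases hef : e = f
      · subst hef
        rw [hx.ghost_edge_self, hx.source_mul_pathElt hβ.2]
        simp only [List.cons_prefix_cons, true_and] at h₁ h₂
        exact ih hα.2 hβ.2 h₁ h₂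
      · rw [hx.ghost_edge_ne _ _ hef, zero_mul, mul_zero]

/-- Left multiplication by a generator shortens paths by at most one edge. -/
theorem gen_mul_mem_longPaths (g : Gen V Ed) (M : ℕ) {a : A}
    (ha : a ∈ longPaths K E x (M + 1)) : x g * a ∈ longPaths K E x M := by
  induction ha using Submodule.span_induction with
  | mem a h =>
    obtain ⟨α, u, v, hα, hM, rfl⟩ := h
    cases g with
    | vertex w =>
      by_cases hw : w = u
      · rw [hw, hx.source_mul_pathElt hα]
        exact Submodule.subset_span ⟨α, u, v, hα, by omega, rfl⟩
      · rw [hx.vertex_mul_pathElt_of_ne hα hw]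
        exact zero_mem _
    | edge e =>
      by_cases hw : E.r e = u
      · exact Submodule.subset_span ⟨e :: α, E.s e, v, ⟨rfl, hw ▸ hα⟩,
          by rw [List.length_cons]; omega, rfl⟩
      · rw [← hx.edge_range, mul_assoc, hx.vertex_mul_pathElt_of_ne hα hw, mul_zero]
        exact zero_mem _
    | ghost e =>
      cases α with
      | nil => simp at hM
      | cons f α =>
        rw [pathElt, ← mul_assoc]
        by_cases hef : e = f
        · subst hef
          rw [hx.ghost_edge_self, hx.source_mul_pathElt hα.2]
          exact Submodule.subset_span ⟨α, _, v, hα.2, by simpa using hM, rfl⟩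
        · rw [hx.ghost_edge_ne _ _ hef, zero_mul]
          exact zero_mem _
  | zero => rw [mul_zero]; exact zero_mem _
  | add a b _ _ ha hb => rw [mul_add]; exact add_mem ha hb
  | smul k a _ ha => rw [mul_smul_comm]; exact Submodule.smul_mem _ _ ha

variable [IsScalarTower K A A]

/-- A generator costs at most one edge, so a product costs at most its number of factors, and a sum
at most the maximum over its terms. -/
theorem exists_mul_mem_longPaths (hgen : NonUnitalAlgebra.adjoin K (Set.range x) = ⊤) (y : A)
    (M : ℕ) : ∃ N, ∀ a ∈ longPaths K E x N, y * a ∈ longPaths K E x M := by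
  have hmono : ∀ {m n : ℕ}, m ≤ n → longPaths K E x n ≤ longPaths K E x m := fun hmn =>
    Submodule.span_mono fun _ ⟨α, u, v, h, hl, ha⟩ => ⟨α, u, v, h, hmn.trans hl, ha⟩
  have hy : y ∈ NonUnitalAlgebra.adjoin K (Set.range x) := hgen ▸ NonUnitalAlgebra.mem_top
  induction hy using NonUnitalAlgebra.adjoin_induction generalizing M with
  | mem y h =>
    obtain ⟨g, rfl⟩ := h
    exact ⟨M + 1, fun a => hx.gen_mul_mem_longPaths g M⟩
  | add y z _ _ hy hz =>
    obtain ⟨N, hN⟩ := hy M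
    obtain ⟨N', hN'⟩ := hz M
    refine ⟨max N N', fun a ha => ?_⟩
    rw [add_mul]
    exact add_mem (hN a (hmono (le_max_left _ _) ha)) (hN' a (hmono (le_max_right _ _) ha))
  | zero => exact ⟨0, fun a _ => by rw [zero_mul]; exact zero_mem _⟩
  | mul y z _ _ hy hz =>
    obtain ⟨N, hN⟩ := hy M
    obtain ⟨N', hN'⟩ := hz N
    exact ⟨N', fun a ha => by rw [mul_assoc]; exact hN _ (hN' a ha)⟩
  | smul k y _ hy =>
    obtain ⟨N, hN⟩ := hy M
    exact ⟨N, fun a ha => by rw [smul_mul_assoc]; exact Submodule.smul_mem _ _ (hN a ha)⟩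

/-- Combinations of paths into `v` are not killed by a path `μ f` that leaves `v` and enters the
hereditary set `H` exactly with its last edge. -/
theorem eq_zero_of_mul_pathElt_eq_zero (hne : ∀ v, x (.vertex v) ≠ 0) {H : Set V}
    (hH : E.IsHereditary H) {μ : List Ed} {f : Ed} {v : V} (hμ : E.IsPath μ v (E.s f))
    (hs : E.s f ∉ H) (hr : E.r f ∈ H) {p : A} (hp : p ∈ longPaths K E x 0)
    (hpv : p * x (.vertex v) = p) (h0 : p * pathElt x (μ ++ [f]) (E.r f) = 0) : p = 0 := by
  have hδ : E.IsPath (μ ++ [f]) v (E.r f) := hμ.append ⟨rfl, rfl⟩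
  -- If `αμf` were a prefix of `βμf` with `α ≠ β`, it would be a prefix of `βμ`; then a path would
  -- lead from `r f ∈ H` to `s f ∉ H`.
  have hpref : ∀ {α β : List Ed} {u w : V}, E.IsPath α u v → E.IsPath β w v →
      α ++ (μ ++ [f]) <+: β ++ (μ ++ [f]) → α = β := by
    intro α β u w hα hβ h
    rw [← List.append_assoc β, List.prefix_concat_iff] at h
    rcases h with h | ⟨τ, hτ⟩
    · rw [List.append_assoc] at h
      exact List.append_cancel_right h
    · have h1 := hβ.append hμ
      rw [← hτ] at h1
      obtain ⟨z, hz, hz'⟩ := E.isPath_append.1 h1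
      obtain ⟨z', -, hz''⟩ := E.isPath_append.1 hz
      obtain ⟨z'', -, -, rfl⟩ := E.isPath_append.1 hz''
      exact absurd (hH _ _ _ hz' hr) hs
  have hspan : p ∈ Submodule.span K
      (Set.range fun α : {α : List Ed // ∃ u, E.IsPath α u v} => pathElt x α.1 v) := by
    rw [← hpv]
    clear h0 hpv
    induction hp using Submodule.span_induction with
    | mem a h =>
      obtain ⟨α, u, w, hα, -, rfl⟩ := h
      by_cases hw : w = v
      · subst hw
        rw [hx.pathElt_mul_range]
        exact Submodule.subset_span ⟨⟨α, u, hα⟩, rfl⟩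
      · rw [hx.pathElt_mul_vertex_of_ne _ hw]
        exact zero_mem _
    | zero => rw [zero_mul]; exact zero_mem _
    | add a b _ _ ha hb => rw [add_mul]; exact add_mem ha hb
    | smul k a _ ha => rw [smul_mul_assoc]; exact Submodule.smul_mem _ _ ha
  obtain ⟨c, rfl⟩ := (Finsupp.mem_span_range_iff_exists_finsupp).1 hspan
  suffices hc : c = 0 by simp [hc]
  ext ⟨α, u, hα⟩
  -- The extended paths being pairwise prefix-incomparable, the ghost of `αμf` isolates the
  -- coefficient of `α`.
  have h1 : ghostElt x (α ++ (μ ++ [f])) (E.r f) *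
      ((c.sum fun i a => a • pathElt x i.1 v) * pathElt x (μ ++ [f]) (E.r f)) =
      c ⟨α, u, hα⟩ • x (.vertex (E.r f)) := by
    rw [Finsupp.sum, Finset.sum_mul, Finset.mul_sum, Finset.sum_eq_single ⟨α, u, hα⟩]
    · rw [smul_mul_assoc, mul_smul_comm, hx.pathElt_mul_pathElt hα hδ,
        hx.ghostElt_mul_pathElt_self (hα.append hδ)]
    · rintro ⟨β, w, hβ⟩ - hαβ
      rw [smul_mul_assoc, mul_smul_comm, hx.pathElt_mul_pathElt hβ hδ,
        hx.ghostElt_mul_pathElt_of_not_prefix (hα.append hδ) (hβ.append hδ), smul_zero]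
      · exact fun h => hαβ (Subtype.ext (hpref hα hβ h).symm)
      · exact fun h => hαβ (Subtype.ext (hpref hβ hα h))
    · intro h
      simp [Finsupp.notMem_support_iff.1 h]
  rw [h0, mul_zero] at h1
  exact (smul_eq_zero.1 h1.symm).resolve_right (hne _)

/-- If `y` annihilates `H` and kills a path all of whose exits lead into `H`, it kills the source of
that path. -/
theorem mul_source_eq_zero (hE : E.RowFinite) {H : Set V} {α : List Ed} {u v : V}
    (hα : E.IsPath α u v) (hexit : ∀ e ∈ α, ∀ g, E.s g = E.s e → g ≠ e → E.r g ∈ H) {y : A}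
    (hy : ∀ b, ∀ h ∈ H, y * (b * x (.vertex h)) = 0) (h0 : y * pathElt x α v = 0) :
    y * x (.vertex u) = 0 := by
  induction α generalizing u y with
  | nil => cases hα; exact h0
  | cons e α ih =>
    obtain ⟨rfl, hα⟩ := hα
    have he : y * x (.edge e) = 0 := by
      rw [← hx.edge_range e, ← mul_assoc]
      -- The induction hypothesis is applied to `y e` in place of `y`.
      refine ih hα (fun e' he' => hexit e' (List.mem_cons_of_mem _ he')) (fun b h hh => ?_) ?_
      · rw [mul_assoc, ← mul_assoc _ b]
        exact hy _ h hh
      · rwa [mul_assoc]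
    rw [hx.regular _ ⟨⟨e, rfl⟩, hE _⟩, Finset.mul_sum]
    refine Finset.sum_eq_zero fun g hg => ?_
    rw [← mul_assoc]
    by_cases hge : g = e
    · rw [hge, he, zero_mul]
    · rw [← hx.edge_range g, hy _ _ (hexit e List.mem_cons_self g (by simpa using hg) hge),
        zero_mul]

/-- An element annihilating `H` also annihilates the base of a cycle outside `H` which has an exit
and whose exits all lead into `H`. -/
theorem mul_base_eq_zero (hgen : NonUnitalAlgebra.adjoin K (Set.range x) = ⊤)
    (hne : ∀ v, x (.vertex v) ≠ 0) (hE : E.RowFinite) {H : Set V} (hH : E.IsHereditary H)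
    {c : List Ed} {v : V} (hc : E.IsPath c v v) (hvH : v ∉ H)
    (hexit : ∀ e ∈ c, ∀ g, E.s g = E.s e → g ≠ e → E.r g ∈ H)
    (hex : ∃ g, E.IsExit g c) {y : A}
    (hy : ∀ b, ∀ h ∈ H, y * (b * x (.vertex h)) = 0) : y * x (.vertex v) = 0 := by
  obtain ⟨f, e, hec, hfe, hne'⟩ := hex
  have hfH := hexit e hec f hfe hne'
  obtain ⟨μ, ν, -, hμ, hν⟩ := hc.exists_split hec
  have hsH : E.s f ∉ H := fun h => hvH (hH (e :: ν) _ _ ⟨rfl, hν⟩ (hfe ▸ h))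
  -- `N` bounds the length `y` can consume; since `c` is nonempty, `c^N` is long enough.
  obtain ⟨N, hN⟩ := hx.exists_mul_mem_longPaths hgen y 0
  have hcN := hc.flatten_replicate N
  have hlen : N ≤ (List.replicate N c).flatten.length := by
    have := List.length_pos_of_mem hec
    simp only [List.length_flatten, List.map_replicate, List.sum_replicate, smul_eq_mul]
    exact Nat.le_mul_of_pos_right N this
  refine hx.mul_source_eq_zero hE hcN (fun e' he' => ?_) hy ?_
  · obtain ⟨l, hl, hel⟩ := List.mem_flatten.1 he'
    exact hexit e' (List.eq_of_mem_replicate hl ▸ hel)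
  · rw [← hfe] at hμ
    refine hx.eq_zero_of_mul_pathElt_eq_zero (K := K) hne hH hμ hsH hfH
      (hN _ (Submodule.subset_span ⟨_, v, v, hcN, hlen, rfl⟩)) ?_ ?_
    · rw [mul_assoc, hx.pathElt_mul_range]
    · rw [← hx.pathElt_mul_range (μ ++ [f]), mul_assoc, ← mul_assoc (pathElt x _ v)]
      exact hy _ _ hfH

end IsLeavittFamily

end Family

end DirectedGraph

namespace DirectedGraph

/-! ### Left-right symmetry via the opposite algebra. -/

section Opposite

variable {V Ed : Type*} {E : DirectedGraph V Ed}

/-- The involution that exchanges edges and ghost edges. -/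
def Gen.swap : Gen V Ed → Gen V Ed
  | .vertex v => .vertex v
  | .edge e => .ghost e
  | .ghost e => .edge e

/-- The defining relations are invariant under reversing products and exchanging `e` with `e*`, so
one-sided results about families transfer to the other side. -/
theorem IsLeavittFamily.op_swap {A : Type*} [NonUnitalRing A] {x : Gen V Ed → A}
    (hx : E.IsLeavittFamily x) :
    E.IsLeavittFamily fun g => MulOpposite.op (x g.swap) where
  idem v := congrArg MulOpposite.op (hx.idem v)
  orth v w h := congrArg MulOpposite.op (hx.orth w v h.symm)
  source_edge e := congrArg MulOpposite.op (hx.ghost_source e)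
  edge_range e := congrArg MulOpposite.op (hx.range_ghost e)
  range_ghost e := congrArg MulOpposite.op (hx.edge_range e)
  ghost_source e := congrArg MulOpposite.op (hx.source_edge e)
  ghost_edge_self e := congrArg MulOpposite.op (hx.ghost_edge_self e)
  ghost_edge_ne e f h := congrArg MulOpposite.op (hx.ghost_edge_ne f e h.symm)
  regular v hv := by
    have h := congrArg MulOpposite.op (hx.regular v hv)
    rwa [Finset.op_sum] at h

variable (K : Type*) [Field K] (E)

theorem LeavittPathAlgebra.adjoin_range_of :
    NonUnitalAlgebra.adjoin K (Set.range (LeavittPathAlgebra.of K E)) = ⊤ := by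
  rw [eq_top_iff]
  rintro ⟨a⟩ -
  change LeavittPathAlgebra.mk K E a ∈ _
  induction a using MonoidAlgebra.induction_linear with
  | zero => rw [map_zero]; exact zero_mem _
  | add a b ha hb => rw [map_add]; exact add_mem ha hb
  | single w k =>
    have hw : MonoidAlgebra.single w k =
        k • MonoidAlgebra.ofMagma K (FreeSemigroup (Gen V Ed)) w := by
      simp [MonoidAlgebra.ofMagma]
    rw [hw, map_smul]
    refine SMulMemClass.smul_mem _ ?_
    clear hw
    induction w using FreeSemigroup.recOnMul with
    | ih1 g => exact NonUnitalAlgebra.subset_adjoin K ⟨g, rfl⟩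
    | ih2 g w hg hw => rw [map_mul, map_mul]; exact mul_mem hg hw

theorem LeavittPathAlgebra.adjoin_range_op_of_swap :
    NonUnitalAlgebra.adjoin K
      (Set.range fun g : Gen V Ed => MulOpposite.op (LeavittPathAlgebra.of K E g.swap)) = ⊤ := by
  rw [eq_top_iff]
  rintro a -
  obtain ⟨a, rfl⟩ := MulOpposite.op_surjective a
  have ha : a ∈ NonUnitalAlgebra.adjoin K (Set.range (LeavittPathAlgebra.of K E)) :=
    LeavittPathAlgebra.adjoin_range_of E K ▸ NonUnitalAlgebra.mem_top
  induction ha using NonUnitalAlgebra.adjoin_induction with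
  | mem a h =>
    obtain ⟨g, rfl⟩ := h
    exact NonUnitalAlgebra.subset_adjoin K ⟨g.swap, by cases g <;> rfl⟩
  | add a b _ _ ha hb => exact add_mem ha hb
  | zero => exact zero_mem _
  | mul a b _ _ ha hb => exact mul_mem hb ha
  | smul k a _ ha => exact SMulMemClass.smul_mem k ha

end Opposite

/-! ### Condition (L) from regularity of the ideal. -/

section Main

variable (K : Type*) [Field K] {V Ed : Type*} {E : DirectedGraph V Ed}

theorem vertex_mem_perp_perp_idealOf (hE : E.RowFinite) {H : Set V} (hH : E.IsHereditary H)
    {c : List Ed} {v : V} (hc : E.IsPath c v v) (hvH : v ∉ H)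
    (hexit : ∀ e ∈ c, ∀ g, E.s g = E.s e → g ≠ e → E.r g ∈ H)
    (hex : ∃ g, E.IsExit g c) :
    LeavittPathAlgebra.of K E (.vertex v) ∈
      perp (perp (E.idealOf K H : Set (LeavittPathAlgebra K E))) := by
  intro a ha
  have hx := LeavittPathAlgebra.isLeavittFamily_of K E
  have hmem : ∀ h ∈ H, LeavittPathAlgebra.of K E (.vertex h) ∈ E.idealOf K H := fun h hh =>
    TwoSidedIdeal.subset_span ⟨h, hh, rfl⟩
  have hne := E.vertex_ne_zero K hE
  constructor
  · have key := hx.op_swap.mul_base_eq_zero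
      (LeavittPathAlgebra.adjoin_range_op_of_swap E K)
      (fun w => by simpa [Gen.swap] using hne w) hE hH hc hvH hexit hex
      (y := MulOpposite.op a) fun b h hh => by
        rw [← MulOpposite.op_unop b, ← MulOpposite.op_mul, ← MulOpposite.op_mul,
          MulOpposite.op_eq_zero_iff]
        exact (ha _ (TwoSidedIdeal.mul_mem_right _ _ _ (hmem h hh))).2
    rwa [← MulOpposite.op_mul, MulOpposite.op_eq_zero_iff] at key
  · exact hx.mul_base_eq_zero (LeavittPathAlgebra.adjoin_range_of E K) hne hE hH hc hvH hexit hex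
      fun b h hh => (ha _ (TwoSidedIdeal.mul_mem_left _ _ _ (hmem h hh))).1

theorem conditionL_quotient_of_isRegularIdeal (hE : E.RowFinite) {H : Set V}
    (hH : E.IsHereditary H) (hS : E.IsSaturated H) (hreg : (E.idealOf K H).IsRegularIdeal)
    (hPc : E.Pc ⊆ H) : (E.quotient H hH).ConditionL := by
  rintro c ⟨hne, ⟨⟨v, hvH⟩, hc⟩, hnd⟩
  by_contra hex
  have hexit : ∀ e ∈ c.map Subtype.val, ∀ g, E.s g = E.s e → g ≠ e → E.r g ∈ H := by
    intro e he g hg hge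
    obtain ⟨e, hec, rfl⟩ := List.mem_map.1 he
    by_contra hgH
    exact hex ⟨⟨g, hgH⟩, e, hec, Subtype.ext hg, fun h => hge (congrArg Subtype.val h)⟩
  have hcE : E.IsPath (c.map Subtype.val) v v := (isPath_map_val hH).2 hc
  -- Without an exit in `E`, the cycle's vertices would lie in `P_c(E) ⊆ H`, yet its edges end
  -- outside `H`.
  have hexE : ∃ g, E.IsExit g (c.map Subtype.val) := by
    by_contra hno
    obtain ⟨e, he⟩ := List.exists_mem_of_ne_nil c hne
    exact e.2 (hPc ⟨_, ⟨mt List.map_eq_nil_iff.1 hne, ⟨v, hcE⟩, (nodup_map_source_val hH).2 hnd⟩, hno,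
      e.1, List.mem_map_of_mem he, Or.inr rfl⟩)
  have hv := vertex_mem_perp_perp_idealOf K hE hH hcE hvH hexit hexE
  rw [← hreg] at hv
  exact hvH (E.mem_of_vertex_mem_idealOf K hE hH hS hv)

end Main

end DirectedGraph

theorem corollary3p9 {V Ed : Type*} (K : Type*) [Field K] (E : DirectedGraph V Ed)
    (hE : E.RowFinite) (H : Set V) (hH : E.IsHereditary H) (hS : E.IsSaturated H) :
    ((E.quotient H hH).ConditionL → E.Pc ⊆ H) ∧
    ((E.idealOf K H).IsRegularIdeal → ((E.quotient H hH).ConditionL ↔ E.Pc ⊆ H)) :=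
  ⟨DirectedGraph.Pc_subset_of_conditionL_quotient hH, fun hreg =>
    ⟨DirectedGraph.Pc_subset_of_conditionL_quotient hH,
      DirectedGraph.conditionL_quotient_of_isRegularIdeal K hE hH hS hreg⟩⟩
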